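/- **Words and distances.** For words $x,y$ over an alphabet, $\mathrm{EDIT}(x,y)$ is the minimum number of symbol insertions, deletions and substitutions needed to transform $x$ into $y$, and $$\mathrm{PAT}(P_1,P_2)=\min\{\mathrm{EDIT}(P_1,x) : x \text{ is a contiguous (possibly empty) subsequence of } P_2\}.$$ $c^n$ is the symbol $c$ repeated $n$ times; juxtaposition and $\bigcirc$ denote concatenation, and $|w|$ is the length of $w$. All words below are over the alphabet $\{0,1,2\}$. **Parameters.** Let $d\ge 0$ be an integer and put $l_0=1000d$, $l_1=(1000d)^2$, $l_2=(1000d)^3$, $l=d(4l_0+2l_1)$, $$E_s=2l_2+l+dl_0,\qquad E_u=l+2l_2+dl_0+d .$$ **Coordinate gadgets.** $$CG_1(0)=0^{l_1}0^{l_0}1^{l_0}1^{l_0}1^{l_0}0^{l_1},\qquad CG_1(1)=0^{l_1}0^{l_0}0^{l_0}0^{l_0}1^{l_0}0^{l_1},$$ $$CG_2(0)=0^{l_1}0^{l_0}0^{l_0}1^{l_0}1^{l_0}0^{l_1},\qquad CG_2(1)=0^{l_1}1^{l_0}1^{l_0}1^{l_0}1^{l_0}0^{l_1},$$ $$g=0^{l_1/2-1}\,1\,0^{l_1/2}\,0^{l_0}1^{l_0}1^{l_0}1^{l_0}0^{l_1}$$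 (for $d=0$ no coordinate gadget and no $g$ is used below). **Vector gadgets.** For $a,b\in\{0,1\}^d$ let $$AG_1(a)=0^{l_2}\Big(\bigcirc_{i=1}^{d} g\Big)1^{l_2}\Big(\bigcirc_{i=1}^{d} CG_1(a_i)\Big)0^{l_2},\qquad AG_2(b)=1^{l_2}\Big(\bigcirc_{i=1}^{d} CG_2(b_i)\Big)1^{l_2}.$$ Their lengths depend only on $d$. Let $t=\max(|AG_1|,|AG_2|)$, $T=1000\,d\,t$, and $AG_k'(a)=2^T AG_k(a)2^T$ for $k\in\{1,2\}$. Let $f\in\{0,1\}^d$ be the all-ones vector. **Theorem.** Let $A,B\subseteq\{0,1\}^d$ with $|A|\le|B|$. List the elements of $A$ and of $B$, each exactly once, in arbitrary orders, and concatenate in these orders: $$P_1=\bigcirc_{a\in A}AG_1'(a),\qquad P_2=\Big(\bigcirc_{i=1}^{|A|-1}AG_2'(f)\Big)\Big(\bigcirc_{b\in B}AG_2'(b)\Big)\Big(\bigcirc_{i=1}^{|A|-1}AG_2'(f)\Big)$$ (concatenations over an empty range are empty). Let $X=|A|\cdot E_u$. 1. If there are $a\in A$ and $b\in B$ with $\sum_{j=1}^d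 a_jb_j=0$, then $\mathrm{PAT}(P_1,P_2)\le X-(E_u-E_s)$. 2. Otherwise $\mathrm{PAT}(P_1,P_2)=X$. -/

import Mathlib

namespace OVPattern

/-! ## Edit distance and pattern matching distance -/

/-- `EditStep x y`: the word `y` arises from `x` by one insertion, deletion or substitution of
a symbol. -/
inductive EditStep {α : Type*} : List α → List α → Prop
  | insertion (u v : List α) (c : α) : EditStep (u ++ v) (u ++ c :: v)
  | deletion (u v : List α) (c : α) : EditStep (u ++ c :: v) (u ++ v)
  | substitution (u v : List α) (c c' : α) : EditStep (u ++ c :: v) (u ++ c' :: v)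

/-- `EditsTo n x y`: the word `x` can be transformed into `y` by `n` successive operations. -/
inductive EditsTo {α : Type*} : ℕ → List α → List α → Prop
  | refl (x : List α) : EditsTo 0 x x
  | step {n : ℕ} {x y z : List α} : EditsTo n x y → EditStep y z → EditsTo (n + 1) x z

/-- The edit distance: the minimum number of insertions, deletions and substitutions of symbols
needed to transform `x` into `y`. The set is never empty, so the infimum is a minimum
(`editDist_spec`). -/
noncomputable def editDist {α : Type*} (x y : List α) : ℕ :=
  sInf {n | EditsTo n x y}

/-- The pattern matching distance: the minimum of `editDist P₁ x` over all contiguous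
subsequences (infixes) `x` of `P₂`. The infimum is a minimum (`patDist_spec`). -/
noncomputable def patDist {α : Type*} (P₁ P₂ : List α) : ℕ :=
  sInf {n | ∃ x : List α, x <:+: P₂ ∧ editDist P₁ x = n}

theorem editsTo_exists {α : Type*} (x y : List α) : ∃ n, EditsTo n x y := by
  have del : ∀ w : List α, ∀ n, EditsTo n x w → ∃ m, EditsTo m x [] := by
    intro w
    induction w with
    | nil => exact fun n h => ⟨n, h⟩
    | cons c w ih => exact fun n h => ih (n + 1) (h.step (EditStep.deletion [] w c))
  obtain ⟨m, hm⟩ := del x 0 (EditsTo.refl x)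
  induction y with
  | nil => exact ⟨m, hm⟩
  | cons c y ih =>
    obtain ⟨n, hn⟩ := ih
    exact ⟨n + 1, hn.step (EditStep.insertion [] y c)⟩

theorem editDist_spec {α : Type*} (x y : List α) :
    IsLeast {n | EditsTo n x y} (editDist x y) :=
  ⟨Nat.sInf_mem (editsTo_exists x y), fun _ h => Nat.sInf_le h⟩

theorem patDist_spec {α : Type*} (P₁ P₂ : List α) :
    IsLeast {n | ∃ x : List α, x <:+: P₂ ∧ editDist P₁ x = n} (patDist P₁ P₂) :=
  ⟨Nat.sInf_mem ⟨_, P₂, List.infix_rfl, rfl⟩, fun _ h => Nat.sInf_le h⟩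

/-! ## Vectors -/

/-- Vectors in `{0,1}^d`. -/
abbrev Vec (d : ℕ) : Type := Fin d → Fin 2

/-- The dot product of two 0-1 vectors, computed in `ℕ` (not modulo 2). -/
def dot {d : ℕ} (a b : Vec d) : ℕ := ∑ j, (a j : ℕ) * (b j : ℕ)

/-- The all-ones vector. -/
def allOnes (d : ℕ) : Vec d := fun _ => 1

/-! ## Gadgets -/

/-- The alphabet `{0,1,2}`. -/
abbrev Sym : Type := Fin 3

/-- The word `c^n`. -/
def run (c : Sym) (n : ℕ) : List Sym := List.replicate n c

def l₀ (d : ℕ) : ℕ := 1000 * d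
def l₁ (d : ℕ) : ℕ := (1000 * d) ^ 2
def l₂ (d : ℕ) : ℕ := (1000 * d) ^ 3

/-- First coordinate gadget. -/
def CG₁ (d : ℕ) (x : Fin 2) : List Sym :=
  if x = 0 then
    run 0 (l₁ d) ++ run 0 (l₀ d) ++ run 1 (l₀ d) ++ run 1 (l₀ d) ++ run 1 (l₀ d) ++ run 0 (l₁ d)
  else
    run 0 (l₁ d) ++ run 0 (l₀ d) ++ run 0 (l₀ d) ++ run 0 (l₀ d) ++ run 1 (l₀ d) ++ run 0 (l₁ d)

/-- Second coordinate gadget. -/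
def CG₂ (d : ℕ) (x : Fin 2) : List Sym :=
  if x = 0 then
    run 0 (l₁ d) ++ run 0 (l₀ d) ++ run 0 (l₀ d) ++ run 1 (l₀ d) ++ run 1 (l₀ d) ++ run 0 (l₁ d)
  else
    run 0 (l₁ d) ++ run 1 (l₀ d) ++ run 1 (l₀ d) ++ run 1 (l₀ d) ++ run 1 (l₀ d) ++ run 0 (l₁ d)

/-- The word `g`; `l₁ d` is even, and it is positive for `d ≥ 1`. For `d = 0` the word `g` is
not used. -/
def g (d : ℕ) : List Sym :=
  run 0 (l₁ d / 2 - 1) ++ [1] ++ run 0 (l₁ d / 2) ++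
    run 0 (l₀ d) ++ run 1 (l₀ d) ++ run 1 (l₀ d) ++ run 1 (l₀ d) ++ run 0 (l₁ d)

/-- The concatenation `w 0 ∘ w 1 ∘ ⋯ ∘ w (d - 1)`. -/
def concat {d : ℕ} (w : Fin d → List Sym) : List Sym := (List.ofFn w).flatten

/-- The vector gadget `Z₁ L V₀ R Z₂`. -/
def AG₁ {d : ℕ} (a : Vec d) : List Sym :=
  run 0 (l₂ d) ++ concat (fun _ : Fin d => g d) ++ run 1 (l₂ d) ++
    concat (fun i => CG₁ d (a i)) ++ run 0 (l₂ d)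

/-- The vector gadget `V₁ D V₂`. -/
def AG₂ {d : ℕ} (b : Vec d) : List Sym :=
  run 1 (l₂ d) ++ concat (fun i => CG₂ d (b i)) ++ run 1 (l₂ d)

/-- The common length `l` of the words `L`, `R`, `D`. -/
def len (d : ℕ) : ℕ := d * (4 * l₀ d + 2 * l₁ d)

/-- `t = max(|AG₁|, |AG₂|)`. The lengths of the vector gadgets depend only on `d`
(see `t_eq`), so they are read off at the all-ones vector. -/
def t (d : ℕ) : ℕ := max (AG₁ (allOnes d)).length (AG₂ (allOnes d)).length

/-- The length of the padding. -/
def T (d : ℕ) : ℕ := 1000 * d * t d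

def AG₁' {d : ℕ} (a : Vec d) : List Sym := run 2 (T d) ++ AG₁ a ++ run 2 (T d)

def AG₂' {d : ℕ} (b : Vec d) : List Sym := run 2 (T d) ++ AG₂ b ++ run 2 (T d)

def Es (d : ℕ) : ℕ := 2 * l₂ d + len d + d * l₀ d

def Eu (d : ℕ) : ℕ := len d + 2 * l₂ d + d * l₀ d + d

/-- `P₁`, for the set `A` listed as `as`. -/
def P₁ {d : ℕ} (as : List (Vec d)) : List Sym := as.flatMap AG₁'

/-- `P₂`, for the sets `A` and `B` listed as `as` and `bs`. -/
def P₂ {d : ℕ} (as bs : List (Vec d)) : List Sym :=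
  (List.replicate (as.length - 1) (AG₂' (allOnes d))).flatten ++
    bs.flatMap AG₂' ++
    (List.replicate (as.length - 1) (AG₂' (allOnes d))).flatten

/-- `as` lists the elements of `A`, each exactly once, in some order. -/
def Lists {d : ℕ} (as : List (Vec d)) (A : Finset (Vec d)) : Prop :=
  as.Nodup ∧ ∀ v, v ∈ as ↔ v ∈ A

theorem length_CG₁ (d : ℕ) (x : Fin 2) : (CG₁ d x).length = 4 * l₀ d + 2 * l₁ d := by
  unfold CG₁ run
  split <;> simp <;> ring

theorem length_CG₂ (d : ℕ) (x : Fin 2) : (CG₂ d x).length = 4 * l₀ d + 2 * l₁ d := by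
  unfold CG₂ run
  split <;> simp <;> ring

theorem length_g (d : ℕ) (hd : 0 < d) : (g d).length = 4 * l₀ d + 2 * l₁ d := by
  have h1 : 2 * (l₁ d / 2) = l₁ d := by
    apply Nat.mul_div_cancel'
    unfold l₁
    exact dvd_pow (Dvd.intro (500 * d) (by ring)) (by norm_num)
  have h2 : 0 < l₁ d := by unfold l₁; positivity
  unfold g run
  simp only [List.length_append, List.length_replicate, List.length_singleton]
  omega

theorem length_concat {d n : ℕ} (w : Fin d → List Sym) (h : ∀ i, (w i).length = n) :
    (concat w).length = d * n := by
  unfold concat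
  simp [List.length_flatten, List.map_ofFn, List.sum_ofFn, h]

theorem length_AG₁ {d : ℕ} (a : Vec d) : (AG₁ a).length = 3 * l₂ d + 2 * len d := by
  unfold AG₁ run
  simp only [List.length_append, List.length_replicate,
    length_concat _ (fun i : Fin d => length_g d (Fin.pos i)),
    length_concat _ (fun i : Fin d => length_CG₁ d (a i))]
  unfold len
  ring

theorem length_AG₂ {d : ℕ} (b : Vec d) : (AG₂ b).length = 2 * l₂ d + len d := by
  unfold AG₂ run
  simp only [List.length_append, List.length_replicate,
    length_concat _ (fun i : Fin d => length_CG₂ d (b i))]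
  unfold len
  ring

theorem t_eq {d : ℕ} (a b : Vec d) : t d = max (AG₁ a).length (AG₂ b).length := by
  simp only [t, length_AG₁, length_AG₂]

end OVPattern

/-!
The upper bounds come from explicit alignments. Turning `AG₁ a = Z₁ L V₀ R Z₂` into
`AG₂ b = V₁ D V₂` costs `E_u` if `V₀` is matched with `V₂` and `L` is turned into `D`
(`align_AG`); if `a` and `b` are orthogonal, it costs only `E_s` to match `V₀` with `V₁` and turn
`R` into `D` (`align_AG_of_dot_eq_zero`). The gadgets of `P₁` are put opposite consecutive
gadgets of `P₂`.

For the lower bound, an alignment of `P₁` with an infix of `P₂` splits into alignments of the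
padded gadgets `AG₁' a` with infixes of `P₂`, so it is enough that each of these costs at least
`E_u` (`le_of_align_AG₁'`). An alignment cheaper than that matches a letter of each of the two
paddings of `AG₁' a`, but cannot insert a padding between them. So exactly one gadget `AG₂ b` lies
in between, all of it, and forgetting the letters `2` leaves an alignment of `AG₁ a` with `AG₂ b`
that is no more expensive.

It remains to see that `AG₁ a` and `AG₂ b` have distance at least `E_u` if `a` and `b` have a common
one (`le_of_align_AG`). Cut `AG₂ b` at the ends of the words aligned with `Z₁, L, V₀, R, Z₂`.
Counting zeros and ones shows that `V₀` meets exactly one of `V₁` and `V₂`, or else the cost is far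
too high. The two cases are
mirror images; if it is `V₁`, then `R` is essentially turned into `D`, up to zeros of `Z₂` behind
`R` and zeros of `D` that are lost in front (`le_of_align_left`, `le_of_align_tail`). Since `R` and
`D` consist of blocks separated by zero runs that are much longer than the budget, the alignment
respects the blocks (`le_of_align_concat`), and a comparison of the numbers of ones block by
block gives the bounds `le_of_align_CG₁` for `R` and `le_of_align_g` for `L`.
-/

namespace OVPattern

/-! ### Alignments -/

/-- `Align n x y`: the words `x` and `y` can be aligned, letter by letter from the left, at a cost
of at most `n`, where equal letters match for free and every substituted, deleted or inserted
letter costs `1`. Since the cost is only bounded, `Align.nil` allows any `n`. -/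
inductive Align {α : Type*} : ℕ → List α → List α → Prop
  | nil (n : ℕ) : Align n [] []
  | keep {n : ℕ} {x y : List α} (c : α) : Align n x y → Align n (c :: x) (c :: y)
  | subst {n : ℕ} {x y : List α} (c c' : α) : Align n x y → Align (n + 1) (c :: x) (c' :: y)
  | delete {n : ℕ} {x y : List α} (c : α) : Align n x y → Align (n + 1) (c :: x) y
  | insert {n : ℕ} {x y : List α} (c : α) : Align n x y → Align (n + 1) x (c :: y)

namespace Align

variable {α : Type*} {m n : ℕ} {x y x' y' : List α}

theorem mono (h : Align m x y) (hmn : m ≤ n) : Align n x y := by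
  induction h generalizing n with
  | nil => exact .nil n
  | keep c _ ih => exact .keep c (ih hmn)
  | subst c c' _ ih =>
    obtain ⟨k, rfl⟩ : ∃ k, n = k + 1 := ⟨n - 1, by omega⟩
    exact .subst c c' (ih (by omega))
  | delete c _ ih =>
    obtain ⟨k, rfl⟩ : ∃ k, n = k + 1 := ⟨n - 1, by omega⟩
    exact .delete c (ih (by omega))
  | insert c _ ih =>
    obtain ⟨k, rfl⟩ : ∃ k, n = k + 1 := ⟨n - 1, by omega⟩
    exact .insert c (ih (by omega))

theorem refl (n : ℕ) (x : List α) : Align n x x := by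
  induction x with
  | nil => exact .nil n
  | cons c x ih => exact .keep c ih

theorem symm (h : Align n x y) : Align n y x := by
  induction h with
  | nil n => exact .nil n
  | keep c _ ih => exact .keep c ih
  | subst c c' _ ih => exact .subst c' c ih
  | delete c _ ih => exact .insert c ih
  | insert c _ ih => exact .delete c ih

theorem append (h : Align m x y) (h' : Align n x' y') : Align (m + n) (x ++ x') (y ++ y') := by
  induction h with
  | nil m => exact h'.mono (by omega)
  | keep c _ ih => exact .keep c ih
  | subst c c' _ ih => rw [add_right_comm]; exact .subst c c' ih
  | delete c _ ih => rw [add_right_comm]; exact .delete c ih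
  | insert c _ ih => rw [add_right_comm]; exact .insert c ih

theorem prepend (h : Align n x y) (u : List α) : Align n (u ++ x) (u ++ y) := by
  simpa using (refl 0 u).append h

theorem nil_right (x : List α) : Align x.length x [] := by
  induction x with
  | nil => exact .nil _
  | cons c x ih => exact .delete c ih

theorem of_length_eq (h : x.length = y.length) : Align x.length x y := by
  induction x generalizing y with
  | nil => rw [List.eq_nil_of_length_eq_zero h.symm]; exact .nil _
  | cons c x ih =>
    cases y with
    | nil => simp at h
    | cons c' y => exact .subst c c' (ih (by simpa using h))

theorem reverse (h : Align n x y) : Align n x.reverse y.reverse := by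
  induction h with
  | nil n => exact .nil n
  | keep c _ ih => simpa using ih.append (refl 0 [c])
  | subst c c' _ ih => simpa using ih.append (.subst c c' (.nil 0))
  | delete c _ ih => simpa using ih.append (.delete c (.nil 0))
  | insert c _ ih => simpa using ih.append (.insert c (.nil 0))

theorem filter (h : Align n x y) (p : α → Bool) : Align n (x.filter p) (y.filter p) := by
  induction h with
  | nil n => exact .nil n
  | keep c _ ih =>
    by_cases hc : p c
    · simpa [hc] using ih.keep c
    · simpa [hc] using ih
  | subst c c' _ ih =>
    by_cases hc : p c <;> by_cases hc' : p c'
    · simpa [hc, hc'] using ih.subst c c'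
    · simpa [hc, hc'] using ih.delete c
    · simpa [hc, hc'] using ih.insert c'
    · simpa [hc, hc'] using ih.mono (Nat.le_succ _)
  | delete c _ ih =>
    by_cases hc : p c
    · simpa [hc] using ih.delete c
    · simpa [hc] using ih.mono (Nat.le_succ _)
  | insert c _ ih =>
    by_cases hc : p c
    · simpa [hc] using ih.insert c
    · simpa [hc] using ih.mono (Nat.le_succ _)

theorem length_le (h : Align n x y) : x.length ≤ y.length + n := by
  induction h <;> simp only [List.length_cons, List.length_nil] <;> omega

theorem countP_le (h : Align n x y) (p : α → Bool) : x.countP p ≤ y.countP p + n := by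
  simpa [List.countP_eq_length_filter] using (h.filter p).length_le

theorem count_le [DecidableEq α] (h : Align n x y) (c : α) : x.count c ≤ y.count c + n :=
  h.countP_le _

/-- An alignment with a concatenation splits into alignments with its parts. -/
theorem split_right {y₁ y₂ : List α} (h : Align n x (y₁ ++ y₂)) :
    ∃ n₁ n₂ x₁ x₂, n = n₁ + n₂ ∧ x = x₁ ++ x₂ ∧ Align n₁ x₁ y₁ ∧ Align n₂ x₂ y₂ := by
  generalize hy : y₁ ++ y₂ = y at h
  induction h generalizing y₁ with
  | nil n =>
    obtain ⟨rfl, rfl⟩ := List.append_eq_nil_iff.1 hy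
    exact ⟨n, 0, [], [], rfl, rfl, .nil n, .nil 0⟩
  | @keep n x y c h ih =>
    cases y₁ with
    | nil =>
      obtain rfl : y₂ = c :: y := hy
      exact ⟨0, n, [], c :: x, by omega, rfl, .nil 0, h.keep c⟩
    | cons b y₁ =>
      obtain ⟨rfl, hy'⟩ := List.cons.inj hy
      obtain ⟨n₁, n₂, x₁, x₂, rfl, rfl, h₁, h₂⟩ := ih hy'
      exact ⟨n₁, n₂, b :: x₁, x₂, rfl, rfl, h₁.keep b, h₂⟩
  | @subst n x y c c' h ih =>
    cases y₁ with
    | nil =>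
      obtain rfl : y₂ = c' :: y := hy
      exact ⟨0, n + 1, [], c :: x, by omega, rfl, .nil 0, h.subst c c'⟩
    | cons b y₁ =>
      obtain ⟨rfl, hy'⟩ := List.cons.inj hy
      obtain ⟨n₁, n₂, x₁, x₂, rfl, rfl, h₁, h₂⟩ := ih hy'
      exact ⟨n₁ + 1, n₂, c :: x₁, x₂, by omega, rfl, h₁.subst c b, h₂⟩
  | @delete n x y c h ih =>
    obtain ⟨n₁, n₂, x₁, x₂, rfl, rfl, h₁, h₂⟩ := ih hy
    exact ⟨n₁ + 1, n₂, c :: x₁, x₂, by omega, rfl, h₁.delete c, h₂⟩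
  | @insert n x y c h ih =>
    cases y₁ with
    | nil =>
      obtain rfl : y₂ = c :: y := hy
      exact ⟨0, n + 1, [], x, by omega, rfl, .nil 0, h.insert c⟩
    | cons b y₁ =>
      obtain ⟨rfl, hy'⟩ := List.cons.inj hy
      obtain ⟨n₁, n₂, x₁, x₂, rfl, rfl, h₁, h₂⟩ := ih hy'
      exact ⟨n₁ + 1, n₂, x₁, x₂, by omega, rfl, h₁.insert b, h₂⟩

theorem split_left {x₁ x₂ : List α} (h : Align n (x₁ ++ x₂) y) :
    ∃ n₁ n₂ y₁ y₂, n = n₁ + n₂ ∧ y = y₁ ++ y₂ ∧ Align n₁ x₁ y₁ ∧ Align n₂ x₂ y₂ := by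
  obtain ⟨n₁, n₂, y₁, y₂, hn, hy, h₁, h₂⟩ := h.symm.split_right
  exact ⟨n₁, n₂, y₁, y₂, hn, hy, h₁.symm, h₂.symm⟩

theorem step {z : List α} (h : Align n x y) (hs : EditStep y z) : Align (n + 1) x z := by
  cases hs with
  | insertion u v c =>
    obtain ⟨n₁, n₂, x₁, x₂, rfl, rfl, h₁, h₂⟩ := h.split_right
    exact h₁.append (h₂.insert c)
  | deletion u v c =>
    obtain ⟨n₁, n₂, x₁, x₂, rfl, rfl, h₁, h₂⟩ := h.split_right
    obtain ⟨k₁, k₂, z₁, z₂, rfl, rfl, h₃, h₄⟩ := split_right (y₁ := [c]) (y₂ := v) h₂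
    have := h₃.length_le
    have h5 := h₁.append ((nil_right z₁).append h₄)
    exact h5.mono (by simp at this; omega)
  | substitution u v c c' =>
    obtain ⟨n₁, n₂, x₁, x₂, rfl, rfl, h₁, h₂⟩ := h.split_right
    obtain ⟨k₁, k₂, z₁, z₂, rfl, rfl, h₃, h₄⟩ := split_right (y₁ := [c]) (y₂ := v) h₂
    have h5 : Align (k₁ + 1) z₁ [c'] := by
      have := h₃.length_le
      cases z₁ with
      | nil => exact ((Align.nil 0).insert c').mono (by omega)
      | cons b z₁ => exact ((nil_right z₁).subst b c').mono (by simp at this; omega)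
    exact (h₁.append (h5.append h₄)).mono (by omega)

theorem of_editsTo (h : EditsTo n x y) : Align n x y := by
  induction h with
  | refl x => exact refl 0 x
  | step _ hs ih => exact ih.step hs

end Align

theorem EditStep.cons {α : Type*} {x y : List α} (h : EditStep x y) (c : α) :
    EditStep (c :: x) (c :: y) := by
  cases h with
  | insertion u v b => exact .insertion (c :: u) v b
  | deletion u v b => exact .deletion (c :: u) v b
  | substitution u v b b' => exact .substitution (c :: u) v b b'

theorem EditsTo.cons {α : Type*} {n : ℕ} {x y : List α} (h : EditsTo n x y) (c : α) :
    EditsTo n (c :: x) (c :: y) := by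
  induction h with
  | refl x => exact .refl _
  | step _ hs ih => exact ih.step (hs.cons c)

theorem Align.editDist_le {α : Type*} {n : ℕ} {x y : List α} (h : Align n x y) :
    editDist x y ≤ n := by
  suffices ∃ m ≤ n, EditsTo m x y by
    obtain ⟨m, hm, he⟩ := this
    exact ((editDist_spec x y).2 he).trans hm
  induction h with
  | nil n => exact ⟨0, n.zero_le, .refl _⟩
  | keep c _ ih =>
    obtain ⟨m, hm, he⟩ := ih
    exact ⟨m, hm, he.cons c⟩
  | @subst n x y c c' _ ih =>
    obtain ⟨m, hm, he⟩ := ih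
    exact ⟨m + 1, by omega, (he.cons c).step (.substitution [] y c c')⟩
  | @delete n x y c _ ih =>
    obtain ⟨m, hm, he⟩ := ih
    exact ⟨m + 1, by omega, (he.cons c).step (.deletion [] y c)⟩
  | @insert n x y c _ ih =>
    obtain ⟨m, hm, he⟩ := ih
    exact ⟨m + 1, by omega, he.step (.insertion [] y c)⟩

theorem align_editDist {α : Type*} (x y : List α) : Align (editDist x y) x y :=
  .of_editsTo (editDist_spec x y).1

/-! ### Runs and concatenations -/

@[simp] theorem length_run (c : Sym) (n : ℕ) : (run c n).length = n := List.length_replicate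

theorem run_add (c : Sym) (m n : ℕ) : run c (m + n) = run c m ++ run c n := by
  simp [run]

@[simp] theorem count_run_self (c : Sym) (n : ℕ) : (run c n).count c = n :=
  List.count_replicate_self

theorem count_run_of_ne {c c' : Sym} (h : c ≠ c') (n : ℕ) : (run c n).count c' = 0 := by
  rw [run, List.count_replicate, if_neg (by simpa using h)]

theorem mem_run {c c' : Sym} {n : ℕ} (h : c' ∈ run c n) : c' = c := List.eq_of_mem_replicate h

@[simp] theorem reverse_run (c : Sym) (n : ℕ) : (run c n).reverse = run c n :=
  List.reverse_replicate

/-- Both parts of a run are runs. -/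
theorem run_eq_append {c : Sym} {n : ℕ} {x y : List Sym} (h : run c n = x ++ y) :
    x = run c x.length ∧ y = run c y.length ∧ x.length + y.length = n := by
  obtain ⟨hn, hx, hy⟩ := List.append_eq_replicate_iff.1 h.symm
  exact ⟨hx, hy, hn⟩

theorem count_zero_add_count_one {w : List Sym} (h : (2 : Sym) ∉ w) :
    w.count 0 + w.count 1 = w.length := by
  induction w with
  | nil => rfl
  | cons c w ih =>
    simp only [List.mem_cons, not_or] at h
    have := ih h.2
    have hc : c = 0 ∨ c = 1 := (by decide : ∀ c : Sym, 2 ≠ c → c = 0 ∨ c = 1) c h.1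
    rcases hc with rfl | rfl <;> simp <;> omega

theorem concat_zero (w : Fin 0 → List Sym) : concat w = [] := by simp [concat]

theorem concat_succ {n : ℕ} (w : Fin (n + 1) → List Sym) :
    concat w = w 0 ++ concat (fun i : Fin n => w i.succ) := by
  simp [concat, List.ofFn_succ]

theorem count_concat {n : ℕ} (w : Fin n → List Sym) (c : Sym) :
    (concat w).count c = ∑ i, (w i).count c := by
  induction n with
  | zero => simp [concat_zero]
  | succ n ih => rw [concat_succ, List.count_append, ih, Fin.sum_univ_succ]

theorem not_mem_concat {n : ℕ} {w : Fin n → List Sym} {c : Sym} (h : ∀ i, c ∉ w i) :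
    c ∉ concat w := by
  rw [← List.count_eq_zero, count_concat]
  exact Finset.sum_eq_zero fun i _ => List.count_eq_zero.2 (h i)

theorem align_concat {n k : ℕ} {w w' : Fin n → List Sym} (h : ∀ i, Align k (w i) (w' i)) :
    Align (n * k) (concat w) (concat w') := by
  induction n with
  | zero => simpa [concat_zero] using Align.nil 0
  | succ n ih =>
    rw [concat_succ, concat_succ]
    exact ((h 0).append (ih fun i => h i.succ)).mono (by ring_nf; omega)

/-- Padding every block on both sides by `u` is the same, up to a cyclic shift, as padding it on
the right by `u ++ u`. -/
theorem concat_pad {n : ℕ} (w : Fin n → List Sym) (u : List Sym) :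
    concat (fun i => u ++ w i ++ u) ++ u = u ++ concat (fun i => w i ++ (u ++ u)) := by
  induction n with
  | zero => simp [concat_zero]
  | succ n ih =>
    rw [concat_succ, concat_succ, List.append_assoc, ih fun i => w i.succ]
    simp only [List.append_assoc]

/-! ### Cheap alignments respect the block structure -/

/-- Words built from blocks of equal length that are separated by runs of `2 * h` zeros. A cheap
alignment shifts positions by so little that all cuts between the target blocks fall into these
runs, so every source block is aligned with its own target block, and the costs of the blocks add
up. The number `e` of leading zeros records the current shift; it differs from `h` by at most what
has been spent so far. -/
theorem sum_le_of_align_blocks {n h B : ℕ} {core D : Fin n → List Sym} {c : Fin n → ℕ}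
    (hcore : ∀ i, (core i).length + 2 * h = B) (hD : ∀ i, (D i).length = B)
    (hc : ∀ i e b m, m ≤ e → e + m ≤ 2 * h → Align m (run 0 e ++ core i ++ run 0 b) (D i) → c i ≤ m)
    {e m : ℕ} {r s : List Sym} (h₁ : m ≤ e) (h₂ : e + m ≤ 2 * h)
    (ha : Align m (run 0 e ++ (concat (fun i => core i ++ (run 0 h ++ run 0 h)) ++ r))
      (concat D ++ s)) :
    ∑ i, c i ≤ m := by
  induction n generalizing e m with
  | zero => simp
  | succ n ih =>
    simp only [concat_succ, List.append_assoc] at ha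
    obtain ⟨m₁, m₂, y, z, rfl, hyz, hy, hz⟩ := ha.split_right
    have l1 := hy.length_le
    have l2 := hy.symm.length_le
    rw [hD] at l1 l2
    have l3 := hcore 0
    -- The cut `y | z` falls into the zeros that follow the first source block.
    have hb : ∃ b e', b + e' = 2 * h ∧ y.length = e + (core 0).length + b :=
      ⟨y.length - e - (core 0).length, 2 * h - (y.length - e - (core 0).length),
        by omega, by omega⟩
    obtain ⟨b, e', hbe, hyb⟩ := hb
    have hsplit : (run 0 e ++ core 0 ++ run 0 b) ++
        (run 0 e' ++ (concat (fun i : Fin n => core i.succ ++ (run 0 h ++ run 0 h)) ++ r)) =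
        y ++ z := by
      have hrun : run 0 b ++ run 0 e' = run 0 h ++ run 0 h := by
        rw [← run_add, ← run_add, hbe, two_mul]
      rw [← hyz, List.append_assoc, ← List.append_assoc (run 0 b), hrun]
      simp only [List.append_assoc]
    obtain ⟨rfl, rfl⟩ := List.append_inj hsplit (by simp [hyb, add_assoc])
    have k1 := hc 0 e b m₁ (by omega) (by omega) hy
    have k2 := ih (fun i => hcore i.succ) (fun i => hD i.succ) (fun i => hc i.succ)
      (by omega) (by omega) hz
    rw [Fin.sum_univ_succ]
    omega

/-- The conclusion of `sum_le_of_align_blocks` for a source word between free runs of zeros and a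
budget `K` that is small compared to the zero runs `0^h` around the blocks. -/
theorem le_of_align_concat {n h B K : ℕ} {core D : Fin n → List Sym} {c : Fin n → ℕ}
    (hcore : ∀ i, (core i).length + 2 * h = B) (hD : ∀ i, (D i).length = B)
    (hc : ∀ i e b m, m ≤ e → e + m ≤ 2 * h → Align m (run 0 e ++ core i ++ run 0 b) (D i) → c i ≤ m)
    (hK : K ≤ ∑ i, c i) (hh : 2 * K ≤ h) {p q m : ℕ}
    (ha : Align m (run 0 p ++ concat (fun i => run 0 h ++ core i ++ run 0 h) ++ run 0 q)
      (concat D)) :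
    K ≤ m := by
  by_contra! hm
  have hl := ha.length_le
  rw [length_concat _ hD, List.length_append, List.length_append, length_concat (n := B) _
    (fun i => by simp [← hcore i]; omega), length_run, length_run] at hl
  -- With `h` more zeros at the end, every block is followed by a full run of `2 * h` zeros.
  have ha' := ha.append (Align.refl 0 (run 0 h))
  rw [List.append_assoc, List.append_assoc, ← run_add, add_comm q, run_add,
    ← List.append_assoc (concat _), concat_pad, List.append_assoc (run 0 h), ← List.append_assoc,
    ← run_add] at ha'
  have := sum_le_of_align_blocks hcore hD hc (by omega) (by omega) ha'
  omega

/-! ### The coordinate gadgets -/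

theorem count_one_CG₁ (d : ℕ) (x : Fin 2) :
    (CG₁ d x).count 1 = if x = 0 then 3 * l₀ d else l₀ d := by
  unfold CG₁
  split
  · simp [count_run_of_ne]
    ring
  · simp [count_run_of_ne]

theorem count_one_CG₂ (d : ℕ) (x : Fin 2) :
    (CG₂ d x).count 1 = if x = 0 then 2 * l₀ d else 4 * l₀ d := by
  unfold CG₂
  split <;> simp [count_run_of_ne] <;> ring

theorem count_one_g (d : ℕ) : (g d).count 1 = 3 * l₀ d + 1 := by
  unfold g
  simp [count_run_of_ne]
  ring

theorem two_notMem_CG₁ (d : ℕ) (x : Fin 2) : (2 : Sym) ∉ CG₁ d x := by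
  unfold CG₁ run
  split <;> simp

theorem two_notMem_CG₂ (d : ℕ) (x : Fin 2) : (2 : Sym) ∉ CG₂ d x := by
  unfold CG₂ run
  split <;> simp

theorem two_notMem_g (d : ℕ) : (2 : Sym) ∉ g d := by
  unfold g run
  simp

theorem two_mul_half_l₁ (d : ℕ) : 2 * (l₁ d / 2) = l₁ d :=
  Nat.mul_div_cancel' (dvd_pow (Dvd.intro (500 * d) (by ring)) (by norm_num))

/-- For `d ≥ 1` the costs of interest are far below the length `l₁` of the zero runs. -/
theorem mul_l₀_add_le_l₁ {d : ℕ} (hd : 0 < d) : 100 * (d * l₀ d + d) + 100 ≤ l₁ d := by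
  unfold l₀ l₁
  nlinarith

/-- If `a` and `b` are not orthogonal, turning the `CG₁` blocks of `a` into the `CG₂` blocks of `b`
costs at least `d * l₀ + d`, even with free zeros around: a pair of blocks differs by at least `l₀`
in the number of ones, and by `3 * l₀` at a common one. -/
theorem le_of_align_CG₁ {d : ℕ} {a b : Vec d} (hab : 0 < dot a b) {p q m : ℕ}
    (ha : Align m (run 0 p ++ concat (fun i => CG₁ d (a i)) ++ run 0 q)
      (concat fun i => CG₂ d (b i))) :
    d * l₀ d + d ≤ m := by
  obtain ⟨j, -, hj⟩ := Finset.exists_ne_zero_of_sum_ne_zero hab.ne'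
  have hd := Fin.pos j
  have hl := mul_l₀_add_le_l₁ hd
  obtain ⟨h, k, hhk, hh⟩ : ∃ h k, h + k = l₁ d ∧ 2 * (d * l₀ d + d) ≤ h :=
    ⟨l₁ d / 2, l₁ d - l₁ d / 2, by omega, by omega⟩
  have hex : ∀ x : Fin 2, ∃ core, CG₁ d x = run 0 h ++ core ++ run 0 h := by
    intro x
    unfold CG₁
    rw [← hhk]
    split
    · exact ⟨run 0 k ++ run 0 (l₀ d) ++ run 1 (l₀ d) ++ run 1 (l₀ d) ++ run 1 (l₀ d) ++ run 0 k, by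
        rw [run_add 0 h k]
        nth_rw 2 [← run_add]
        rw [add_comm h k, run_add 0 k h]
        simp only [List.append_assoc]⟩
    · exact ⟨run 0 k ++ run 0 (l₀ d) ++ run 0 (l₀ d) ++ run 0 (l₀ d) ++ run 1 (l₀ d) ++ run 0 k, by
        rw [run_add 0 h k]
        nth_rw 2 [← run_add]
        rw [add_comm h k, run_add 0 k h]
        simp only [List.append_assoc]⟩
  choose core hcore using hex
  simp only [hcore] at ha
  refine le_of_align_concat (B := 4 * l₀ d + 2 * l₁ d)
    (c := fun i => l₀ d + if i = j then 2 * l₀ d else 0) (fun i => ?_)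
    (fun i => length_CG₂ d (b i)) ?_ ?_ hh ha
  · have := length_CG₁ d (a i)
    rw [hcore] at this
    simp at this
    omega
  · intro i e r m _ _ hm
    have h1 := hm.count_le 1
    have h2 := hm.symm.count_le 1
    have h3 := count_one_CG₁ d (a i)
    rw [hcore] at h3
    simp only [List.count_append, count_run_of_ne (show (0 : Sym) ≠ 1 by decide), zero_add,
      add_zero, count_one_CG₂] at h1 h2 h3
    rw [h3] at h1 h2
    by_cases hi : i = j
    · subst hi
      have h4 : a i ≠ 0 := by rintro h; simp [h] at hj
      have h5 : b i ≠ 0 := by rintro h; simp [h] at hj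
      simp only [h4, h5, if_false, if_true] at h1 h2 ⊢
      omega
    · simp only [hi, if_false]
      split_ifs at h1 h2 <;> omega
  · have : d ≤ l₀ d := by unfold l₀; omega
    rw [Finset.sum_add_distrib, Finset.sum_ite_eq' Finset.univ j]
    simp
    omega

/-- Turning the blocks `g` into `CG₂` blocks costs at least `d * l₀ + d`, even with free zeros
around: apart from the `l₀` for the number of ones, each isolated one is `l₁ / 2` positions away
from the next one and so cannot be matched. -/
theorem le_of_align_g {d : ℕ} (b : Vec d) {p q m : ℕ}
    (ha : Align m (run 0 p ++ concat (fun _ : Fin d => g d) ++ run 0 q)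
      (concat fun i => CG₂ d (b i))) :
    d * l₀ d + d ≤ m := by
  rcases Nat.eq_zero_or_pos d with rfl | hd
  · simp
  have hl := mul_l₀_add_le_l₁ hd
  have hl2 := two_mul_half_l₁ d
  obtain ⟨h, hh⟩ : ∃ h, h = l₁ d / 2 - 1 := ⟨_, rfl⟩
  have hg : g d = run 0 h ++ ([1] ++ (run 0 (l₁ d / 2) ++ run 0 (l₀ d) ++ run 1 (l₀ d) ++
      run 1 (l₀ d) ++ run 1 (l₀ d) ++ run 0 (l₁ d - h))) ++ run 0 h := by
    unfold g
    rw [show l₁ d = (l₁ d - h) + h by omega, run_add 0 (l₁ d - h) h,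
      show (l₁ d - h) + h = l₁ d by omega, ← hh]
    simp only [List.append_assoc]
  have hlen := length_g d hd
  simp only [hg] at ha hlen
  refine le_of_align_concat (B := 4 * l₀ d + 2 * l₁ d)
    (c := fun _ => l₀ d + 1) (fun i => ?_)
    (fun i => length_CG₂ d (b i)) ?_ ?_ (by omega) ha
  · rw [List.length_append, List.length_append, length_run] at hlen
    omega
  · intro i e r m _ he hm
    rw [List.append_assoc, List.append_assoc] at hm
    obtain ⟨m₁, m₂, w₁, w', rfl, hw, h₁, h'⟩ := hm.split_left
    obtain ⟨m₃, m₄, w₂, w₃, rfl, rfl, h₂, h₃⟩ := h'.split_left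
    have hone := congrArg (List.count 1) hw
    simp only [List.count_append, count_one_CG₂] at hone
    have c1 := h₁.symm.count_le 1
    have c2 := h₂.count_le 1
    have c3 := h₃.symm.count_le 1
    have c4 := h₃.count_le 1
    have s1 := h₁.symm.length_le
    have s2 := h₂.symm.length_le
    simp only [List.count_append, count_run_of_ne (show (0 : Sym) ≠ 1 by decide), zero_add,
      add_zero, count_run_self, List.count_singleton_self, length_run, List.length_singleton]
      at c1 c2 c3 c4 s1 s2
    -- The isolated one is aligned within the leading zeros of the target block.
    have c5 : w₂.count 1 = 0 := by
      obtain ⟨v, hv⟩ : ∃ v, CG₂ d (b i) = run 0 (l₁ d) ++ v := by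
        unfold CG₂
        split <;> exact ⟨_, by simp only [List.append_assoc]; rfl⟩
      rw [hv, ← List.append_assoc] at hw
      obtain ⟨u, hu, -⟩ | ⟨u, hu, -⟩ := List.append_eq_append_iff.1 hw
      · have := congrArg List.length hu
        simp at this
        omega
      · rw [List.append_assoc] at hu
        obtain ⟨-, hu', -⟩ := run_eq_append hu
        obtain ⟨hu', -, -⟩ := run_eq_append hu'.symm
        rw [hu', count_run_of_ne (by decide)]
    split_ifs at hone <;> omega
  · simp [mul_add]

/-! ### The edit distance of two vector gadgets -/

theorem eq_run_of_prefix {c : Sym} {p : ℕ} {x y z : List Sym} (h : run c p ++ x = y ++ z)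
    (hy : y.length ≤ p) : y = run c y.length := by
  obtain ⟨v, hv, -⟩ | ⟨v, hv, -⟩ := List.append_eq_append_iff.1 h
  · have hl := congrArg List.length hv
    rw [List.length_append, length_run] at hl
    rw [hv, List.eq_nil_of_length_eq_zero (l := v) (by omega)]
    simp
  · exact (run_eq_append hv).1

/-- Let `R` end with at least `K` zeros, and let `R` have distance at least `K` from `D`, even
with free zeros around `R`. Then the zeros behind `R` cannot help against the ones behind `D`. -/
theorem le_of_align_tail {p q K n : ℕ} {R R₀ D : List Sym} (hR : R = R₀ ++ run 0 K)
    (key : ∀ b m, Align m (run 0 q ++ R ++ run 0 b) D → K ≤ m)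
    (h : Align n (run 0 q ++ R ++ run 0 p) (D ++ run 1 p)) : p + K ≤ n := by
  obtain ⟨m₁, m₂, y, z, rfl, hyz, hy, hz⟩ := h.split_right
  obtain ⟨u, rfl, hu⟩ | ⟨u, hu, rfl⟩ := List.append_eq_append_iff.1 hyz
  · obtain ⟨hu, hz', -⟩ := run_eq_append hu
    rw [hu] at hy
    have h1 := key _ _ hy
    rw [hz'] at hz
    have h2 := hz.symm.count_le 1
    rw [count_run_self, count_run_of_ne (by decide)] at h2
    omega
  · have h1 := hz.count_le 0
    rw [List.count_append, count_run_self, count_run_of_ne (by decide)] at h1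
    by_contra! hn
    rw [hR, ← List.append_assoc] at hu
    obtain ⟨v, hv, hv'⟩ | ⟨v, hv, hv'⟩ := List.append_eq_append_iff.1 hu
    · obtain ⟨-, hu', -⟩ := run_eq_append hv'
      have h2 : u.count 0 = u.length := by rw [hu', count_run_self, length_run]
      have h3 := hy.append (Align.nil_right u)
      rw [← hu, List.append_nil, List.append_assoc, ← hR] at h3
      have h4 := key 0 _ (by simpa [run] using h3)
      omega
    · rw [hv', List.count_append, count_run_self] at h1
      omega

/-- The case of an alignment in which the middle run of ones starts inside the first run of ones
and does not reach the second one. Here `p` stands for `l₂`, `q` for the common length of the words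
`L`, `R`, `D`, and `w₁, …, w₅` are the words aligned with `0^p`, `L`, `1^p`, `R`, `0^p`. -/
theorem le_of_align_left {p q K s : ℕ} {L R R₀ D D₀ w₁ w₂ w₃ w₄ w₅ : List Sym}
    {n₁ n₂ n₃ n₄ n₅ : ℕ} (hL : L.length = q) (hRq : R.length = q) (hDq : D.length = q)
    (hR2 : (2 : Sym) ∉ R) (hD2 : (2 : Sym) ∉ D) (hRs : R.count 1 ≤ s)
    (hR : R = R₀ ++ run 0 K) (hD : D = run 0 (K + s) ++ D₀)
    (key : ∀ c b m, Align m (run 0 c ++ R ++ run 0 b) D → K ≤ m)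
    (h : run 1 p ++ (D ++ run 1 p) = w₁ ++ w₂ ++ w₃ ++ (w₄ ++ w₅))
    (hw₂ : (w₁ ++ w₂).length ≤ p) (hw₃ : (w₁ ++ w₂ ++ w₃).length ≤ p + q)
    (a₁ : Align n₁ (run 0 p) w₁) (a₂ : Align n₂ L w₂) (a₃ : Align n₃ (run 1 p) w₃)
    (a₄ : Align n₄ R w₄) (a₅ : Align n₅ (run 0 p) w₅) :
    2 * p + q + K ≤ n₁ + n₂ + n₃ + n₄ + n₅ := by
  have b₂ := a₂.length_le
  rw [hL] at b₂
  obtain ⟨u, hu, hu'⟩ | ⟨u, hu, hu'⟩ := List.append_eq_append_iff.1 h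
  · -- The middle run reaches into `D`; let `u` be the part of `D` in front of the next cut.
    have hw12 := eq_run_of_prefix hu.symm hw₂
    obtain ⟨hw1, hw2, -⟩ := run_eq_append hw12.symm
    have b₁ := a₁.count_le 0
    rw [hw1, count_run_self, count_run_of_ne (by decide)] at b₁
    have b₃ := a₃.count_le 1
    have hc := congrArg (List.count 1) hu
    have hl := congrArg List.length hu
    simp only [List.count_append, List.length_append, length_run, count_run_self] at b₃ hc hl hw₃
    have e1 : w₁.count 1 = w₁.length := by rw [hw1, count_run_self, length_run]
    have e2 : w₂.count 1 = w₂.length := by rw [hw2, count_run_self, length_run]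
    obtain ⟨v, hv, hv'⟩ : ∃ v, D = u ++ v ∧ w₄ ++ w₅ = v ++ run 1 p := by
      obtain ⟨v, hv, hv'⟩ | ⟨v, hv, hv'⟩ := List.append_eq_append_iff.1 hu'
      · have : v = [] := by
          have := congrArg List.length hv
          rw [List.length_append] at this
          exact List.length_eq_zero_iff.1 (by omega)
        subst this
        exact ⟨[], by simpa using hv.symm, by simpa using hv'.symm⟩
      · exact ⟨v, hv, hv'⟩
    have b₄ := a₄.count_le 0
    have b₅ := a₅.count_le 0
    rw [count_run_self] at b₅
    have hc' := congrArg (List.count 0) hv'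
    simp only [List.count_append, count_run_of_ne (show (1 : Sym) ≠ 0 by decide)] at hc'
    have c1 := count_zero_add_count_one hR2
    have c2 := count_zero_add_count_one hD2
    have c3 := count_zero_add_count_one (w := u) fun hm => hD2 (hv ▸ List.mem_append_left _ hm)
    have c4 := congrArg (List.count 0) hv
    have c5 := congrArg (List.count 1) hv
    rw [List.count_append] at c4 c5
    by_contra! hn
    -- The zeros of `u` are lost, so there are few of them, and `u` consists of zeros only.
    have hu0 : u.count 0 < K + s := by omega
    have hur : u = run 0 u.length := by
      obtain ⟨x, hx, -⟩ | ⟨x, hx, -⟩ := List.append_eq_append_iff.1 (hD.symm.trans hv)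
      · rw [hx, List.count_append, count_run_self] at hu0
        omega
      · exact (run_eq_append hx).1
    have h1 := (a₄.append a₅).prepend u
    rw [hv', ← List.append_assoc u v, ← hv, ← List.append_assoc, hur] at h1
    have h2 := le_of_align_tail hR (key _) h1
    have e3 : u.count 1 = 0 := by rw [hur, count_run_of_ne (by decide)]
    omega
  · -- The middle run ends within the first run of ones; the ones `u` that it leaves are as bad
    -- for `R` as they would have been good for the middle run.
    obtain ⟨hw, hur, hl⟩ := run_eq_append hu
    obtain ⟨hw12, -, -⟩ := run_eq_append hw.symm
    obtain ⟨hw1, -, -⟩ := run_eq_append hw12.symm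
    have b₁ := a₁.count_le 0
    rw [hw1, count_run_self, count_run_of_ne (by decide)] at b₁
    have b₃ := a₃.length_le
    have h1 := a₄.append a₅
    rw [hu'] at h1
    obtain ⟨m₁, m₂, y, z, hm, hyz, hy, hz⟩ := h1.split_right
    have h2 := (Align.nil_right y).append hz
    rw [← hyz, List.nil_append] at h2
    have h3 := le_of_align_tail (q := 0) hR (key _) (by simpa [run] using h2)
    have h4 := hy.length_le
    simp only [List.length_append, length_run] at b₃ hl
    omega

theorem concat_prefix {n : ℕ} (hn : 0 < n) {w : Fin n → List Sym} {u : List Sym}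
    (h : ∀ i, ∃ v, w i = u ++ v) : ∃ v, concat w = u ++ v := by
  cases n with
  | zero => omega
  | succ n =>
    obtain ⟨v, hv⟩ := h 0
    exact ⟨_, by rw [concat_succ, hv, List.append_assoc]⟩

theorem concat_suffix {n : ℕ} (hn : 0 < n) {w : Fin n → List Sym} {u : List Sym}
    (h : ∀ i, ∃ v, w i = v ++ u) : ∃ v, concat w = v ++ u := by
  induction n with
  | zero => omega
  | succ n ih =>
    rcases Nat.eq_zero_or_pos n with rfl | hn
    · simpa [concat_succ, concat_zero] using h 0
    · obtain ⟨v, hv⟩ := ih hn fun i => h i.succ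
      exact ⟨w 0 ++ v, by rw [concat_succ, hv, List.append_assoc]⟩

theorem run_eq_of_le (c : Sym) {k n : ℕ} (h : k ≤ n) :
    run c n = run c k ++ run c (n - k) ∧ run c n = run c (n - k) ++ run c k := by
  constructor <;> rw [← run_add] <;> congr 1 <;> omega

theorem CG₁_suffix {d k : ℕ} (h : k ≤ l₁ d) (x : Fin 2) : ∃ v, CG₁ d x = v ++ run 0 k := by
  unfold CG₁
  split <;> exact ⟨_, by rw [(run_eq_of_le 0 h).2, ← List.append_assoc]⟩

theorem CG₂_suffix {d k : ℕ} (h : k ≤ l₁ d) (x : Fin 2) : ∃ v, CG₂ d x = v ++ run 0 k := by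
  unfold CG₂
  split <;> exact ⟨_, by rw [(run_eq_of_le 0 h).2, ← List.append_assoc]⟩

theorem CG₂_prefix {d k : ℕ} (h : k ≤ l₁ d) (x : Fin 2) : ∃ v, CG₂ d x = run 0 k ++ v := by
  unfold CG₂
  split <;> exact ⟨_, by simp only [(run_eq_of_le 0 h).1, List.append_assoc]; rfl⟩

theorem g_prefix {d k : ℕ} (h : k ≤ l₁ d / 2 - 1) : ∃ v, g d = run 0 k ++ v := by
  unfold g
  exact ⟨_, by rw [(run_eq_of_le 0 h).1]; simp only [List.append_assoc]; rfl⟩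

/-- For `d ≥ 1` the runs of length `l₂` dwarf the words `L`, `R` and `D`. -/
theorem five_mul_len_le_l₂ {d : ℕ} (hd : 0 < d) : 5 * len d + (d * l₀ d + d) ≤ l₂ d := by
  unfold len l₀ l₁ l₂
  have h2 : d ≤ d ^ 2 := Nat.le_self_pow two_ne_zero d
  have h3 : d ^ 2 ≤ d ^ 3 := Nat.pow_le_pow_right hd (by norm_num)
  ring_nf
  omega

/-- The words `AG₁ a` and `AG₂ b` of non-orthogonal vectors have edit distance at least `E_u`. -/
theorem le_of_align_AG {d : ℕ} {a b : Vec d} (hab : 0 < dot a b) {n : ℕ}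
    (h : Align n (AG₁ a) (AG₂ b)) : Eu d ≤ n := by
  have hd : 0 < d := by
    obtain ⟨j, -, -⟩ := Finset.exists_ne_zero_of_sum_ne_zero hab.ne'
    exact Fin.pos j
  have hl₁ := mul_l₀_add_le_l₁ hd
  obtain ⟨L, hL⟩ : ∃ L, L = concat (fun _ : Fin d => g d) := ⟨_, rfl⟩
  obtain ⟨R, hR⟩ : ∃ R, R = concat (fun i => CG₁ d (a i)) := ⟨_, rfl⟩
  obtain ⟨D, hD⟩ : ∃ D, D = concat (fun i => CG₂ d (b i)) := ⟨_, rfl⟩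
  have lL : L.length = len d := by rw [hL, length_concat _ fun _ => length_g d hd]; rfl
  have lR : R.length = len d := by rw [hR, length_concat _ fun i => length_CG₁ d (a i)]; rfl
  have lD : D.length = len d := by rw [hD, length_concat _ fun i => length_CG₂ d (b i)]; rfl
  have nL : (2 : Sym) ∉ L := hL ▸ not_mem_concat fun _ => two_notMem_g d
  have nR : (2 : Sym) ∉ R := hR ▸ not_mem_concat fun i => two_notMem_CG₁ d (a i)
  have nD : (2 : Sym) ∉ D := hD ▸ not_mem_concat fun i => two_notMem_CG₂ d (b i)
  have cL : L.count 1 ≤ 3 * (d * l₀ d) + d := by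
    rw [hL, count_concat]
    simp [count_one_g, mul_add]
    exact le_of_eq (by ring)
  have cR : R.count 1 ≤ 3 * (d * l₀ d) + d := by
    have : ∀ i, (CG₁ d (a i)).count 1 ≤ 3 * l₀ d := by
      intro i
      rw [count_one_CG₁]
      split <;> omega
    have h1 := Finset.sum_le_sum fun i (_ : i ∈ Finset.univ) => this i
    rw [← count_concat, ← hR, Finset.sum_const, Finset.card_univ, Fintype.card_fin,
      smul_eq_mul] at h1
    linarith
  have hl₂ := five_mul_len_le_l₂ hd
  have hlen : len d = 4 * (d * l₀ d) + 2 * (d * l₁ d) := by unfold len; ring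
  have hl₁' : l₁ d ≤ d * l₁ d := Nat.le_mul_of_pos_left _ hd
  obtain ⟨s, hs⟩ : ∃ s, s = 3 * (d * l₀ d) + d := ⟨_, rfl⟩
  obtain ⟨K, hK⟩ : ∃ K, K = d * l₀ d + d := ⟨_, rfl⟩
  have keyR : ∀ c e m, Align m (run 0 c ++ R ++ run 0 e) D → K ≤ m := by
    rw [hR, hD, hK]
    exact fun c e m => le_of_align_CG₁ hab
  have keyL : ∀ c e m, Align m (run 0 c ++ L ++ run 0 e) D → K ≤ m := by
    rw [hL, hD, hK]
    exact fun c e m => le_of_align_g b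
  obtain ⟨L₀, hL₀⟩ : ∃ L₀, L = run 0 K ++ L₀ :=
    hL ▸ concat_prefix hd fun _ => g_prefix (by omega)
  obtain ⟨R₀, hR₀⟩ : ∃ R₀, R = R₀ ++ run 0 K :=
    hR ▸ concat_suffix hd fun _ => CG₁_suffix (by omega) _
  obtain ⟨D₀, hD₀⟩ : ∃ D₀, D = run 0 (K + s) ++ D₀ :=
    hD ▸ concat_prefix hd fun _ => CG₂_prefix (by omega) _
  obtain ⟨D₁, hD₁⟩ : ∃ D₁, D = D₁ ++ run 0 (K + s) :=
    hD ▸ concat_suffix hd fun _ => CG₂_suffix (by omega) _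
  unfold AG₁ AG₂ at h
  rw [← hL, ← hR, ← hD] at h
  obtain ⟨n', n₅, w', w₅, rfl, hw, h, a₅⟩ := h.split_left
  obtain ⟨n', n₄, w', w₄, rfl, rfl, h, a₄⟩ := h.split_left
  obtain ⟨n', n₃, w', w₃, rfl, rfl, h, a₃⟩ := h.split_left
  obtain ⟨n₁, n₂, w₁, w₂, rfl, rfl, a₁, a₂⟩ := h.split_left
  have hwl := congrArg List.length hw
  simp only [List.length_append, length_run, lD] at hwl
  have hEu : Eu d = 2 * l₂ d + len d + K := by unfold Eu; omega
  rw [hEu]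
  by_cases c₁ : (w₁ ++ w₂).length ≤ l₂ d ∧ (w₁ ++ w₂ ++ w₃).length ≤ l₂ d + len d
  · exact le_of_align_left lL lR lD nR nD (hs ▸ cR) hR₀ hD₀ keyR
      (by simpa only [List.append_assoc] using hw) c₁.1 c₁.2 a₁ a₂ a₃ a₄ a₅
  -- The mirror image of the first case.
  by_cases c₂ : (w₅ ++ w₄).length ≤ l₂ d ∧ (w₅ ++ w₄ ++ w₃).length ≤ l₂ d + len d
  · have hw' := congrArg List.reverse hw
    simp only [List.reverse_append, reverse_run] at hw'
    have r₁ := a₁.reverse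
    have r₃ := a₃.reverse
    have r₅ := a₅.reverse
    rw [reverse_run] at r₁ r₃ r₅
    have := le_of_align_left (p := l₂ d) (q := len d) (K := K) (s := s)
      (L := R.reverse) (R := L.reverse) (R₀ := L₀.reverse)
      (D := D.reverse) (D₀ := D₁.reverse) (by simpa) (by simpa) (by simpa) (by simpa) (by simpa)
      (by rw [List.count_reverse]; omega) (by simp [hL₀])
      (by rw [hD₁, List.reverse_append, reverse_run])
      (fun c e m h => keyL e c m (by simpa [List.append_assoc] using h.reverse))
      (by simpa only [List.append_assoc] using hw') (by simpa [add_comm] using c₂.1)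
      (by simpa [add_comm] using c₂.2) r₅ a₄.reverse r₃ a₂.reverse r₁
    omega
  simp only [List.length_append] at c₁ c₂
  have b₁ := a₁.count_le 0
  have b₂ := a₂.count_le 0
  have b₃ := a₃.length_le
  have b₄ := a₄.count_le 0
  have b₅ := a₅.count_le 0
  rw [count_run_self] at b₁ b₅
  rw [length_run] at b₃
  have z₁ := count_zero_add_count_one nL
  have z₂ := count_zero_add_count_one nR
  have z₃ := congrArg (List.count 0) hw
  simp only [List.count_append, count_run_of_ne (show (1 : Sym) ≠ 0 by decide)] at z₃
  have z₄ : D.count 0 ≤ D.length := List.count_le_length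
  by_cases c₃ : (w₁ ++ w₂).length ≤ l₂ d
  · -- The middle run is aligned with a word that contains all of `D`, so no zero is matched.
    have hp := eq_run_of_prefix (y := w₁ ++ w₂) (z := w₃ ++ (w₄ ++ w₅))
      (by simpa only [List.append_assoc] using hw) (by simpa using c₃)
    have hs := eq_run_of_prefix (c := 1) (p := l₂ d) (y := w₅.reverse ++ w₄.reverse)
      (by simpa only [List.reverse_append, reverse_run, List.append_assoc]
        using congrArg List.reverse hw) (by simp; simp at c₃; omega)
    have hp0 := congrArg (List.count 0) hp
    have hs0 := congrArg (List.count 0) hs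
    simp only [List.count_append, List.count_reverse,
      count_run_of_ne (show (1 : Sym) ≠ 0 by decide)] at hp0 hs0
    omega
  · -- The middle run is aligned with a part of `D`, which is far too short.
    rw [List.length_append] at c₃
    omega

/-! ### Padding -/

/-- The word `w` without its letters `2`. -/
def dropTwos (w : List Sym) : List Sym := w.filter (· ≠ 2)

theorem dropTwos_append (x y : List Sym) : dropTwos (x ++ y) = dropTwos x ++ dropTwos y :=
  List.filter_append ..

theorem dropTwos_run_two (n : ℕ) : dropTwos (run 2 n) = [] := by
  simp [dropTwos, run]

theorem dropTwos_of_notMem {w : List Sym} (h : (2 : Sym) ∉ w) : dropTwos w = w := by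
  unfold dropTwos
  rw [List.filter_eq_self]
  intro c hc
  simpa using fun h' : c = 2 => h (h' ▸ hc)

theorem dropTwos_reverse (w : List Sym) : dropTwos w.reverse = (dropTwos w).reverse :=
  List.filter_reverse ..

theorem length_dropTwos_le {n k : ℕ} {w : List Sym} (h : Align n (run 2 k) w) :
    (dropTwos w).length ≤ n := by
  have := (h.symm.filter (· ≠ 2)).length_le
  rw [show (run 2 k).filter (· ≠ 2) = [] from dropTwos_run_two k] at this
  simpa [dropTwos] using this

theorem two_mem_of_align {n k : ℕ} {w : List Sym} (h : Align n (run 2 k) w) (hn : n < k) :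
    (2 : Sym) ∈ w := by
  have := h.count_le 2
  rw [count_run_self] at this
  exact List.count_pos_iff.1 (by omega)

theorem two_notMem_AG₁ {d : ℕ} (a : Vec d) : (2 : Sym) ∉ AG₁ a := by
  unfold AG₁
  simp only [List.mem_append, not_or]
  exact ⟨⟨⟨⟨fun h => absurd (mem_run h) (by decide), not_mem_concat fun _ => two_notMem_g d⟩,
    fun h => absurd (mem_run h) (by decide)⟩, not_mem_concat fun i => two_notMem_CG₁ d (a i)⟩,
    fun h => absurd (mem_run h) (by decide)⟩

theorem two_notMem_AG₂ {d : ℕ} (b : Vec d) : (2 : Sym) ∉ AG₂ b := by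
  unfold AG₂
  simp only [List.mem_append, not_or]
  exact ⟨⟨fun h => absurd (mem_run h) (by decide), not_mem_concat fun i => two_notMem_CG₂ d (b i)⟩,
    fun h => absurd (mem_run h) (by decide)⟩

/-- In a word `s ++ x ++ y` that ends with a full padding `2^k` followed by a word `e` without `2`,
suppose that `x` contains a `2` and `y` does not contain `k` of them. Then `x` and `y` cover `e`. -/
theorem exists_prefix_of_two_mem {k : ℕ} {s x y e r : List Sym}
    (h : s ++ x ++ y = r ++ run 2 k ++ e) (he : (2 : Sym) ∉ e) (hx : (2 : Sym) ∈ x)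
    (hy : y.count 2 < k) :
    ∃ f, e = f ++ dropTwos y ∧ f.length ≤ (dropTwos x).length := by
  obtain ⟨u, hu, rfl⟩ | ⟨u, hu, rfl⟩ := List.append_eq_append_iff.1 h
  · refine ⟨[], ?_, by simp⟩
    obtain ⟨v, -, hv⟩ | ⟨v, -, rfl⟩ := List.append_eq_append_iff.1 hu
    · rw [dropTwos_append, (run_eq_append hv).2.1, dropTwos_run_two, dropTwos_of_notMem he]
      rfl
    · simp only [List.count_append, count_run_self] at hy
      omega
  · rw [List.mem_append, not_or] at he
    refine ⟨u, by rw [dropTwos_of_notMem he.2], ?_⟩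
    obtain ⟨v, -, rfl⟩ | ⟨v, -, rfl⟩ := List.append_eq_append_iff.1 hu
    · rw [dropTwos_append, dropTwos_of_notMem he.1]
      simp
    · exact absurd (List.mem_append_right _ hx) he.1

theorem append_eq_append_cons {α : Type*} {u v p q : List α} {c : α} (h : u ++ v = p ++ c :: q) :
    (∃ w, u = p ++ c :: w ∧ q = w ++ v) ∨ ∃ w, p = u ++ w ∧ v = w ++ c :: q := by
  obtain ⟨w, hw, hw'⟩ | ⟨w, hw, hw'⟩ := List.append_eq_append_iff.1 h
  · exact .inr ⟨w, hw, hw'⟩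
  · cases w with
    | nil => exact .inr ⟨[], by simpa using hw.symm, hw'.symm⟩
    | cons c' w =>
      obtain ⟨rfl, rfl⟩ := List.cons.inj hw'
      exact .inl ⟨w, hw, rfl⟩

/-- A letter other than `2` of a concatenation of padded gadgets lies in one of the gadgets. -/
theorem exists_gadget {d : ℕ} {bs : List (Vec d)} {p q : List Sym} {c : Sym} (hc : c ≠ 2)
    (h : bs.flatMap AG₂' = p ++ c :: q) :
    ∃ b ∈ bs, ∃ r e e' r', AG₂ b = e ++ c :: e' ∧ p = r ++ run 2 (T d) ++ e ∧
      q = e' ++ run 2 (T d) ++ r' := by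
  induction bs generalizing p with
  | nil => simp at h
  | cons b bs ih =>
    rw [List.flatMap_cons] at h
    have h2 : ∀ {u v : List Sym} {n : ℕ}, run 2 n ≠ u ++ c :: v := fun {u v n} h => by
      have : c ∈ run 2 n := by simp [h]
      exact hc (mem_run this)
    obtain ⟨w, hw, rfl⟩ | ⟨w, rfl, hw⟩ := append_eq_append_cons h
    · refine ⟨b, List.mem_cons_self, ?_⟩
      obtain ⟨e', he', rfl⟩ | ⟨e, -, he⟩ := append_eq_append_cons hw
      · obtain ⟨w, hw, -⟩ | ⟨e, rfl, he⟩ := append_eq_append_cons he'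
        · exact (h2 hw).elim
        · exact ⟨[], e, e', bs.flatMap AG₂', he, by simp, by simp⟩
      · exact (h2 he).elim
    · obtain ⟨b', hb', r, e, e', r', h₁, rfl, h₃⟩ := ih hw
      exact ⟨b', List.mem_cons_of_mem _ hb', AG₂' b ++ r, e, e', r', h₁,
        by simp only [List.append_assoc], h₃⟩

theorem Eu_le {d : ℕ} (a : Vec d) : Eu d ≤ (AG₁ a).length ∧ Eu d ≤ T d := by
  have h : Eu d ≤ (AG₁ a).length := by
    rw [length_AG₁]
    unfold Eu
    rcases Nat.eq_zero_or_pos d with rfl | hd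
    · simp [len, l₂]
    · have := five_mul_len_le_l₂ hd
      omega
  refine ⟨h, ?_⟩
  rcases Nat.eq_zero_or_pos d with rfl | hd
  · simp [Eu, l₂, l₀, len]
  · have ht : Eu d ≤ t d := h.trans ((le_max_left _ _).trans_eq (t_eq a a).symm)
    exact ht.trans (Nat.le_mul_of_pos_left _ (by positivity))

/-- A padded gadget has distance at least `E_u` from every infix of a concatenation of padded
gadgets of vectors that are not orthogonal to the given one: an alignment cheaper than that has to
match a letter of both paddings, and a whole gadget lies in between. -/
theorem le_of_align_AG₁' {d : ℕ} {a : Vec d} {bs : List (Vec d)} (h : ∀ b ∈ bs, 0 < dot a b)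
    {x : List Sym} (hx : x <:+: bs.flatMap AG₂') {n : ℕ} (hn : Align n (AG₁' a) x) : Eu d ≤ n := by
  by_contra! hlt
  obtain ⟨hE, hT⟩ := Eu_le a
  obtain ⟨n', n₃, x', x₃, rfl, rfl, hn', h₃⟩ := hn.split_left
  obtain ⟨n₁, n₂, x₁, x₂, rfl, rfl, h₁, h₂⟩ := hn'.split_left
  obtain ⟨s, s', hs⟩ := hx
  have hm₁ := two_mem_of_align h₁ (by omega)
  have hm₃ := two_mem_of_align h₃ (by omega)
  have hdrop := h₂.filter (· ≠ 2)
  rw [show (AG₁ a).filter (· ≠ 2) = AG₁ a from dropTwos_of_notMem (two_notMem_AG₁ a)] at hdrop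
  -- The gadget has no letter `2`, so the paddings that its partner `x₂` contains are inserted.
  have hc₂ := h₂.symm.count_le 2
  rw [List.count_eq_zero.2 (two_notMem_AG₁ a)] at hc₂
  obtain ⟨c, hcx, hc⟩ : ∃ c ∈ x₂, c ≠ 2 := by
    by_contra! hall
    have : x₂.filter (· ≠ 2) = [] := by simpa using hall
    rw [this] at hdrop
    have := hdrop.length_le
    simp at this
    omega
  obtain ⟨y, z, rfl⟩ := List.append_of_mem hcx
  obtain ⟨b, hb, r, e, e', r', hbe, he, he'⟩ := exists_gadget (p := s ++ x₁ ++ y)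
    (q := z ++ x₃ ++ s') hc (by rw [← hs]; simp only [List.append_assoc, List.cons_append])
  have he2 := two_notMem_AG₂ b
  rw [hbe, List.mem_append, List.mem_cons, not_or, not_or] at he2
  rw [List.count_append, List.count_cons] at hc₂
  obtain ⟨f, rfl, hf⟩ := exists_prefix_of_two_mem he he2.1 hm₁ (by omega)
  obtain ⟨f', hf', hfl'⟩ := exists_prefix_of_two_mem (s := s'.reverse) (x := x₃.reverse)
    (y := z.reverse) (e := e'.reverse) (r := r'.reverse) (k := T d)
    (by simpa [List.append_assoc] using congrArg List.reverse he')
    (by simpa using he2.2.2) (by simpa using hm₃) (by rw [List.count_reverse]; omega)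
  rw [dropTwos_reverse, ← List.reverse_inj, List.reverse_reverse, List.reverse_append,
    List.reverse_reverse] at hf'
  rw [dropTwos_reverse, List.length_reverse] at hfl'
  -- The letters `f`, `f'` of `AG₂ b` outside `x₂` lie opposite the paddings, at cost `1` each.
  have hfull := ((Align.nil_right f).symm.append hdrop).append (Align.nil_right f').symm.reverse
  have hAG : f ++ (y ++ c :: z).filter (· ≠ 2) ++ f'.reverse = AG₂ b := by
    rw [hbe, hf', List.filter_append, List.filter_cons_of_pos (by simpa using hc)]
    simp only [dropTwos, List.append_assoc, List.cons_append]
  rw [hAG] at hfull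
  have h5 := le_of_align_AG (h b hb) (by simpa using hfull)
  have h6 := length_dropTwos_le h₁
  have h7 := length_dropTwos_le h₃
  omega

/-- An alignment of `P₁` splits into alignments of its gadgets with infixes of the target. -/
theorem le_of_align_P₁ {d : ℕ} {as bs : List (Vec d)} (h : ∀ a ∈ as, ∀ b ∈ bs, 0 < dot a b)
    {x : List Sym} (hx : x <:+: bs.flatMap AG₂') {n : ℕ} (hn : Align n (P₁ as) x) :
    as.length * Eu d ≤ n := by
  induction as generalizing x n with
  | nil => simp
  | cons a as ih =>
    rw [P₁, List.flatMap_cons] at hn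
    obtain ⟨n₁, n₂, x₁, x₂, rfl, rfl, h₁, h₂⟩ := hn.split_left
    have k₁ := le_of_align_AG₁' (h a List.mem_cons_self)
      ((List.prefix_append x₁ x₂).isInfix.trans hx) h₁
    have k₂ := ih (fun a ha => h a (List.mem_cons_of_mem _ ha))
      ((List.suffix_append x₁ x₂).isInfix.trans hx) h₂
    rw [List.length_cons, add_mul]
    omega

/-! ### Cheap alignments -/

theorem align_run (c c' : Sym) (n : ℕ) : Align n (run c n) (run c' n) := by
  simpa using Align.of_length_eq (x := run c n) (y := run c' n) (by simp)

theorem align_CG {d : ℕ} {x y : Fin 2} (h : (x : ℕ) * y = 0) :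
    Align (l₀ d) (CG₁ d x) (CG₂ d y) := by
  have hs := align_run 1 0 (l₀ d)
  have key : ∀ (u v : List Sym) {z w : List Sym}, Align (l₀ d) z w →
      Align (l₀ d) (u ++ (z ++ v)) (u ++ (w ++ v)) := fun u v _ _ h =>
    (h.append (.refl 0 v)).prepend u
  unfold CG₁ CG₂
  fin_cases x <;> fin_cases y
  · simpa [List.append_assoc] using key (run 0 (l₁ d) ++ run 0 (l₀ d))
      (run 1 (l₀ d) ++ (run 1 (l₀ d) ++ run 0 (l₁ d))) hs
  · simpa [List.append_assoc] using key (run 0 (l₁ d))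
      (run 1 (l₀ d) ++ (run 1 (l₀ d) ++ (run 1 (l₀ d) ++ run 0 (l₁ d)))) hs.symm
  · simpa [List.append_assoc] using key (run 0 (l₁ d) ++ (run 0 (l₀ d) ++ run 0 (l₀ d)))
      (run 1 (l₀ d) ++ run 0 (l₁ d)) hs.symm
  · simp at h

theorem align_g {d : ℕ} (hd : 0 < d) (y : Fin 2) : Align (l₀ d + 1) (g d) (CG₂ d y) := by
  have hl := mul_l₀_add_le_l₁ hd
  have hl2 := two_mul_half_l₁ d
  have hs := align_run 1 0 (l₀ d)
  have h : Align (1 + l₀ d) (g d) (CG₂ d y) := by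
    have h1 : Align 1 (run 0 (l₁ d / 2 - 1) ++ [1] ++ run 0 (l₁ d / 2)) (run 0 (l₁ d)) := by
      rw [show run 0 (l₁ d) = run 0 (l₁ d / 2 - 1) ++ [0] ++ run 0 (l₁ d / 2) by
        rw [show ([0] : List Sym) = run 0 1 from rfl, ← run_add, ← run_add]; congr 1; omega]
      exact ((Align.nil 0).subst 1 0 |>.prepend _).append (.refl 0 _)
    unfold g CG₂
    split
    · have h2 := (hs.append (.refl 0 (run 1 (l₀ d) ++ (run 1 (l₀ d) ++ run 0 (l₁ d))))).prepend
        (run 0 (l₀ d))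
      simpa [List.append_assoc] using h1.append h2
    · have h2 := hs.symm.append
        (.refl 0 (run 1 (l₀ d) ++ (run 1 (l₀ d) ++ (run 1 (l₀ d) ++ run 0 (l₁ d)))))
      simpa [List.append_assoc] using h1.append h2
  rwa [add_comm] at h

/-- For orthogonal vectors, the ones of `AG₁ a` are matched with the first run of ones of
`AG₂ b`. -/
theorem align_AG_of_dot_eq_zero {d : ℕ} {a b : Vec d} (h : dot a b = 0) :
    Align (Es d) (AG₁ a) (AG₂ b) := by
  have hR : Align (d * l₀ d) (concat fun i => CG₁ d (a i)) (concat fun i => CG₂ d (b i)) :=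
    align_concat fun i => align_CG (Finset.sum_eq_zero_iff.1 h i (Finset.mem_univ i))
  have h1 := (((Align.nil_right (run 0 (l₂ d) ++ concat fun _ : Fin d => g d)).append
    (.refl 0 (run 1 (l₂ d)))).append hR).append (align_run 0 1 (l₂ d))
  refine h1.mono (le_of_eq ?_)
  rw [List.length_append, length_run, length_concat _ fun i : Fin d => length_g d (Fin.pos i), Es,
    len]
  ring

/-- In general, the ones of `AG₁ a` are matched with the second run of ones of `AG₂ b`. -/
theorem align_AG {d : ℕ} (a b : Vec d) : Align (Eu d) (AG₁ a) (AG₂ b) := by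
  have hL : Align (d * (l₀ d + 1)) (concat fun _ : Fin d => g d) (concat fun i => CG₂ d (b i)) :=
    align_concat fun i => align_g (Fin.pos i) (b i)
  have h1 := (((align_run 0 1 (l₂ d)).append hL).append (.refl 0 (run 1 (l₂ d)))).append
    (Align.nil_right ((concat fun i => CG₁ d (a i)) ++ run 0 (l₂ d)))
  have h2 : Align (Eu d) (AG₁ a) (AG₂ b ++ []) := by
    unfold AG₁ AG₂
    rw [List.append_assoc _ (concat fun i => CG₁ d (a i))]
    refine h1.mono (le_of_eq ?_)
    rw [List.length_append, length_run, length_concat _ fun i : Fin d => length_CG₁ d (a i), Eu,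
      len]
    ring
  rwa [List.append_nil] at h2

theorem align_pad {d n : ℕ} {a b : Vec d} (h : Align n (AG₁ a) (AG₂ b)) :
    Align n (AG₁' a) (AG₂' b) :=
  (h.prepend (run 2 (T d))).append (.refl 0 (run 2 (T d)))

theorem align_flatMap {d : ℕ} {as bs : List (Vec d)} (h : as.length = bs.length) :
    Align (as.length * Eu d) (as.flatMap AG₁') (bs.flatMap AG₂') := by
  induction as generalizing bs with
  | nil =>
    rw [List.eq_nil_of_length_eq_zero h.symm]
    exact .nil _
  | cons a as ih =>
    cases bs with
    | nil => simp at h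
    | cons b bs =>
      rw [List.flatMap_cons, List.flatMap_cons]
      refine ((align_pad (align_AG a b)).append (ih (by simpa using h))).mono (le_of_eq ?_)
      rw [List.length_cons]
      ring

/-! ### The pattern matching distance -/

theorem P₂_eq {d : ℕ} (as bs : List (Vec d)) :
    P₂ as bs = (List.replicate (as.length - 1) (allOnes d) ++ bs ++
      List.replicate (as.length - 1) (allOnes d)).flatMap AG₂' := by
  simp [P₂, List.flatMap_def]

theorem patDist_le {α : Type*} {n : ℕ} {p q x : List α} (hx : x <:+: q) (h : Align n p x) :
    patDist p q ≤ n :=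
  ((patDist_spec p q).2 ⟨x, hx, rfl⟩).trans h.editDist_le

theorem infix_flatMap {α β : Type*} {f : α → List β} {x y : List α} (h : x <:+: y) :
    x.flatMap f <:+: y.flatMap f := by
  obtain ⟨s, t, rfl⟩ := h
  exact ⟨s.flatMap f, t.flatMap f, by simp only [List.flatMap_append]⟩

theorem patDist_le_mul_Eu {d : ℕ} {as bs : List (Vec d)} (h : as.length ≤ bs.length) :
    patDist (P₁ as) (P₂ as bs) ≤ as.length * Eu d := by
  rw [P₂_eq]
  refine patDist_le (infix_flatMap ?_)
    (align_flatMap (as := as) (bs := bs.take as.length) (by simp [h]))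
  exact (List.take_prefix _ _).isInfix.trans (List.infix_append _ _ _)

/-- The copies of `AG₂' (allOnes d)` at both ends leave room to put the gadgets of any `a` and `b`
opposite each other. -/
theorem patDist_le_of_dot_eq_zero {d : ℕ} {as bs : List (Vec d)} {a b : Vec d} (ha : a ∈ as)
    (hb : b ∈ bs) (h : dot a b = 0) :
    patDist (P₁ as) (P₂ as bs) ≤ (as.length - 1) * Eu d + Es d := by
  rw [P₂_eq]
  obtain ⟨as₁, as₂, rfl⟩ := List.append_of_mem ha
  obtain ⟨bs₁, bs₂, rfl⟩ := List.append_of_mem hb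
  obtain ⟨r, hr⟩ : ∃ r, r = List.replicate ((as₁ ++ a :: as₂).length - 1) (allOnes d) := ⟨_, rfl⟩
  have hrl : r.length = as₁.length + as₂.length := by
    rw [hr, List.length_replicate, List.length_append, List.length_cons]
    omega
  rw [← hr]
  obtain ⟨u, hu⟩ : ∃ u, u = (r ++ bs₁).drop ((r ++ bs₁).length - as₁.length) := ⟨_, rfl⟩
  obtain ⟨v, hv⟩ : ∃ v, v = (bs₂ ++ r).take as₂.length := ⟨_, rfl⟩
  have hul : as₁.length = u.length := by
    rw [hu, List.length_drop, List.length_append]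
    omega
  have hvl : as₂.length = v.length := by
    rw [hv, List.length_take, List.length_append]
    omega
  have hinf : u ++ b :: v <:+: r ++ (bs₁ ++ b :: bs₂) ++ r := by
    obtain ⟨s, hs⟩ : u <:+ r ++ bs₁ := hu ▸ List.drop_suffix _ _
    obtain ⟨s', hs'⟩ : v <+: bs₂ ++ r := hv ▸ List.take_prefix _ _
    refine ⟨s, s', ?_⟩
    calc s ++ (u ++ b :: v) ++ s' = (s ++ u) ++ b :: (v ++ s') := by simp
      _ = _ := by rw [hs, hs']; simp
  refine patDist_le (infix_flatMap hinf) ?_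
  rw [P₁, List.flatMap_append, List.flatMap_append, List.flatMap_cons, List.flatMap_cons]
  refine ((align_flatMap hul).append ((align_pad (align_AG_of_dot_eq_zero h)).append
    (align_flatMap hvl))).mono (le_of_eq ?_)
  rw [List.length_append, List.length_cons,
    show as₁.length + (as₂.length + 1) - 1 = as₁.length + as₂.length by omega]
  ring

theorem mul_Eu_le_patDist {d : ℕ} {as bs : List (Vec d)} (hbs : bs ≠ [])
    (h : ∀ a ∈ as, ∀ b ∈ bs, 0 < dot a b) :
    as.length * Eu d ≤ patDist (P₁ as) (P₂ as bs) := by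
  obtain ⟨x, hx, hn⟩ := (patDist_spec (P₁ as) (P₂ as bs)).1
  rw [← hn]
  rw [P₂_eq] at hx
  refine le_of_align_P₁ (fun a ha b hb => ?_) hx (align_editDist _ _)
  have hone : 0 < dot a (allOnes d) := by
    -- A vector that is orthogonal to no vector of `bs` is nonzero.
    obtain ⟨b', hb'⟩ := List.exists_mem_of_ne_nil bs hbs
    obtain ⟨j, -, hj⟩ := Finset.exists_ne_zero_of_sum_ne_zero (h a ha b' hb').ne'
    refine Finset.sum_pos' (fun _ _ => Nat.zero_le _) ⟨j, Finset.mem_univ j, ?_⟩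
    simpa [allOnes] using Nat.pos_of_ne_zero (left_ne_zero_of_mul hj)
  rw [List.mem_append, List.mem_append] at hb
  obtain (hb | hb) | hb := hb
  · rwa [List.eq_of_mem_replicate hb]
  · exact h a ha b hb
  · rwa [List.eq_of_mem_replicate hb]

theorem Lists.length_eq {d : ℕ} {as : List (Vec d)} {A : Finset (Vec d)} (h : Lists as A) :
    as.length = A.card := by
  rw [← List.toFinset_card_of_nodup h.1]
  congr 1
  ext v
  simp [h.2]

end OVPattern

theorem mainTheorem3 (d : ℕ) (A B : Finset (OVPattern.Vec d)) (hAB : A.card ≤ B.card)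
    (as bs : List (OVPattern.Vec d))
    (has : OVPattern.Lists as A) (hbs : OVPattern.Lists bs B)
    (X : ℕ) (hX : X = A.card * OVPattern.Eu d) :
    ((∃ a ∈ A, ∃ b ∈ B, OVPattern.dot a b = 0) →
      (OVPattern.patDist (OVPattern.P₁ as) (OVPattern.P₂ as bs) : ℤ) ≤
        (X : ℤ) - ((OVPattern.Eu d : ℤ) - (OVPattern.Es d : ℤ))) ∧
    ((¬ ∃ a ∈ A, ∃ b ∈ B, OVPattern.dot a b = 0) →
      OVPattern.patDist (OVPattern.P₁ as) (OVPattern.P₂ as bs) = X) := by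
  have hA := has.length_eq
  have hB := hbs.length_eq
  subst hX
  rw [← hA]
  constructor
  · rintro ⟨a, ha, b, hb, hab⟩
    have h := OVPattern.patDist_le_of_dot_eq_zero ((has.2 a).2 ha) ((hbs.2 b).2 hb) hab
    have hpos : 1 ≤ as.length := List.length_pos_of_mem ((has.2 a).2 ha)
    zify [hpos] at h
    push_cast
    linarith
  · intro h
    push Not at h
    refine le_antisymm (OVPattern.patDist_le_mul_Eu (by omega)) ?_
    rcases eq_or_ne bs [] with hnil | hne
    · have : as.length = 0 := by
        rw [hnil, List.length_nil] at hB
        omega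
      simp [this]
    · exact OVPattern.mul_Eu_le_patDist hne fun a ha b hb =>
        Nat.pos_of_ne_zero (h a ((has.2 a).1 ha) b ((hbs.2 b).1 hb))
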